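/- Let $X$ be a complex Banach space with an unconditional Schauder basis $(e_j)_{j\ge 1}$ that is normalized ($\|e_j\|=1$ for all $j$) and has unconditional basis constant $1$, i.e. $\bigl\|\sum_{j} a_j e_j\bigr\|\le \bigl\|\sum_{j} c_j e_j\bigr\|$ for all finite sums with complex scalars satisfying $|a_j|\le |c_j|$ for all $j$. Suppose that the dual space $X^*$ is uniformly complex convex, i.e. for every $\varepsilon>0$ $$\inf\Bigl\{\sup_{\theta\in\mathbb{R}}\|x^*+e^{i\theta}y^*\|-1 \;:\; x^*,y^*\in X^*,\ \|x^*\|=1,\ \|y^*\|\ge\varepsilon\Bigr\}>0 .$$ Then $X^*$ admits a uniformly simultaneously continuous retraction: there is a map $r$ from $X^*$ into its closed unit ball $B_{X^*}$ with $r(x^*)=x^*$ for all $x^*\in B_{X^*}$, which is uniformly continuous for the norm and continuous for the weak-$*$ topology (on both $X^*$ and $B_{X^*}$). -/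

import Mathlib

open scoped ENNReal

/-- The unconditional basis constant: the least `K` (possibly `∞`) such that
`‖∑ a_j e_j‖ ≤ K ‖∑ c_j e_j‖` for all finite sums with scalars satisfying `|a_j| ≤ |c_j|`. -/
noncomputable def unconditionalBasisConstant {𝕜 X : Type*} [RCLike 𝕜] [NormedAddCommGroup X]
    [NormedSpace 𝕜 X] (e : UnconditionalSchauderBasis ℕ 𝕜 X) : ℝ≥0∞ :=
  sInf {K : ℝ≥0∞ | ∀ (s : Finset ℕ) (a c : ℕ → 𝕜), (∀ j ∈ s, ‖a j‖ ≤ ‖c j‖) →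
    ‖∑ j ∈ s, a j • e j‖ₑ ≤ K * ‖∑ j ∈ s, c j • e j‖ₑ}

/-- Uniform complex convexity: for every `ε > 0`, the modulus
`inf {sup_θ ‖x + exp (i θ) y‖ - 1 : ‖x‖ = 1, ‖y‖ ≥ ε}` is positive. The supremum over `θ` is
attained, by compactness of the circle. -/
def UniformlyComplexConvex (E : Type*) [NormedAddCommGroup E] [NormedSpace ℂ E] : Prop :=
  ∀ ε : ℝ, 0 < ε → ∃ δ : ℝ, 0 < δ ∧ ∀ x y : E, ‖x‖ = 1 → ε ≤ ‖y‖ →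
    ∃ θ : ℝ, 1 + δ ≤ ‖x + Complex.exp (θ * Complex.I) • y‖

/-- `r` is a uniformly simultaneously continuous retraction of the dual of `X` onto its closed unit
ball: a retraction that is uniformly continuous for the norm and continuous for the weak-*
topology. -/
structure IsUniformlySimultaneouslyContinuousRetraction (𝕜 X : Type*) [RCLike 𝕜]
    [NormedAddCommGroup X] [NormedSpace 𝕜 X] (r : StrongDual 𝕜 X → StrongDual 𝕜 X) : Prop where
  norm_le_one : ∀ f, ‖r f‖ ≤ 1
  eq_self : ∀ f, ‖f‖ ≤ 1 → r f = f
  uniformContinuous : UniformContinuous r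
  weakStar_continuous :
    Continuous fun f : WeakDual 𝕜 X => StrongDual.toWeakDual (r (WeakDual.toStrongDual f))

/-- The dual of `X` admits a uniformly simultaneously continuous retraction. -/
def AdmitsUniformlySimultaneouslyContinuousRetraction (𝕜 X : Type*) [RCLike 𝕜]
    [NormedAddCommGroup X] [NormedSpace 𝕜 X] : Prop :=
  ∃ r : StrongDual 𝕜 X → StrongDual 𝕜 X, IsUniformlySimultaneouslyContinuousRetraction 𝕜 X r

open Filter Topology

/-! A functional outside the ball is retracted by reading its coordinates in order, the last one
fractionally, and stopping when the norm reaches one. Let `f` and `f'` be close, with `f` stopping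
first, at `s`. Cutting `f'` at `s` gives `u`, whose norm is almost one because it is close to the
truncation `g` of `f`. Rotating the remainder `g' - u` of the truncation of `f'` keeps the
coordinates of `u + exp (iθ) (g' - u)` below those of `g'` in modulus, so by unconditionality the
norm stays at most one; complex convexity then makes `g' - u` small. This is
`norm_sub_le_of_initial_segments`. For weak-* continuity, the first `n` coordinates of the
truncation depend only on the first `n` coordinates of `f`, and on bounded sets coordinatewise
continuity suffices. -/

theorem norm_sum_smul_le_of_unconditionalBasisConstant_le_one {𝕜 X : Type*} [RCLike 𝕜]
    [NormedAddCommGroup X] [NormedSpace 𝕜 X] {e : UnconditionalSchauderBasis ℕ 𝕜 X}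
    (hunc : unconditionalBasisConstant e ≤ 1) (s : Finset ℕ) (a c : ℕ → 𝕜)
    (h : ∀ j ∈ s, ‖a j‖ ≤ ‖c j‖) :
    ‖∑ j ∈ s, a j • e j‖ ≤ ‖∑ j ∈ s, c j • e j‖ := by
  rw [← enorm_le_iff_norm_le]
  refine le_of_forall_gt_imp_ge_of_dense fun t ht => ?_
  by_contra! hlt
  set C := ‖∑ j ∈ s, c j • e j‖ₑ with hC
  have hCtop : C ≠ ∞ := enorm_ne_top
  have hlim : Tendsto (fun K : ℝ≥0∞ => K * C) (𝓝 1) (𝓝 (1 * C)) :=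
    ENNReal.Tendsto.mul_const tendsto_id (Or.inr hCtop)
  rw [one_mul] at hlim
  obtain ⟨K, hK1, hK⟩ : ∃ K : ℝ≥0∞, 1 < K ∧ K * C < t := by
    have : (𝓝[>] (1 : ℝ≥0∞)).NeBot := nhdsGT_neBot_of_exists_gt ⟨2, by norm_num⟩
    have h1 : ∀ᶠ K in 𝓝[>] (1 : ℝ≥0∞), K * C < t :=
      (hlim.eventually (gt_mem_nhds ht)).filter_mono nhdsWithin_le_nhds
    exact (eventually_mem_nhdsWithin.and h1).exists
  obtain ⟨K', hK'mem, hK'⟩ := sInf_lt_iff.1 (lt_of_le_of_lt hunc hK1)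
  exact (lt_of_le_of_lt ((hK'mem s a c h).trans (mul_le_mul_left hK'.le C)) hK).not_gt hlt

/-- In the dual of a space with a `1`-unconditional basis the norm is monotone in the moduli of the
coordinates. -/
theorem norm_le_norm_of_norm_apply_basis_le {𝕜 X : Type*} [RCLike 𝕜]
    [NormedAddCommGroup X] [NormedSpace 𝕜 X] {e : UnconditionalSchauderBasis ℕ 𝕜 X}
    (hunc : unconditionalBasisConstant e ≤ 1) {f g : StrongDual 𝕜 X}
    (h : ∀ j, ‖f (e j)‖ ≤ ‖g (e j)‖) : ‖f‖ ≤ ‖g‖ := by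
  refine f.opNorm_le_bound (norm_nonneg _) fun x => ?_
  have hx : Tendsto (fun A => e.proj A x) (SummationFilter.unconditional ℕ).filter (𝓝 x) :=
    e.tendsto_proj x
  refine le_of_tendsto_of_tendsto ((f.continuous.tendsto x).comp hx).norm
    (hx.norm.const_mul ‖g‖) (Eventually.of_forall fun A => ?_)
  simp only [Function.comp_apply, GeneralSchauderBasis.proj_apply]
  set a : ℕ → 𝕜 := fun j => e.coord j x
  have hphase : ∀ z : 𝕜, ∃ c : 𝕜, ‖c‖ = 1 ∧ (‖z‖ : 𝕜) = c * z := RCLike.exists_norm_eq_mul_self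
  choose c hc1 hc using hphase
  -- The phases rule out cancellation in `g (∑ b j • e j)`.
  set b : ℕ → 𝕜 := fun j => (‖a j‖ : 𝕜) * c (g (e j))
  have hb : ∀ j, ‖b j‖ = ‖a j‖ := fun j => by simp [b, hc1]
  have hg : g (∑ j ∈ A, b j • e j) = ((∑ j ∈ A, ‖a j‖ * ‖g (e j)‖ : ℝ) : 𝕜) := by
    simp [b, mul_assoc, ← hc]
  calc ‖f (∑ j ∈ A, a j • e j)‖ ≤ ∑ j ∈ A, ‖a j‖ * ‖f (e j)‖ := by
        rw [map_sum]
        refine (norm_sum_le _ _).trans (le_of_eq ?_)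
        simp
    _ ≤ ∑ j ∈ A, ‖a j‖ * ‖g (e j)‖ :=
        Finset.sum_le_sum fun j _ => mul_le_mul_of_nonneg_left (h j) (norm_nonneg _)
    _ = ‖g (∑ j ∈ A, b j • e j)‖ := by
        rw [hg, RCLike.norm_ofReal, abs_of_nonneg]
        exact Finset.sum_nonneg fun j _ => by positivity
    _ ≤ ‖g‖ * ‖∑ j ∈ A, b j • e j‖ := g.le_opNorm _
    _ ≤ ‖g‖ * ‖∑ j ∈ A, a j • e j‖ := by
        gcongr
        exact norm_sum_smul_le_of_unconditionalBasisConstant_le_one hunc A b a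
          fun j _ => (hb j).le

theorem eq_of_apply_basis_eq {𝕜 X : Type*} [RCLike 𝕜]
    [NormedAddCommGroup X] [NormedSpace 𝕜 X] (e : UnconditionalSchauderBasis ℕ 𝕜 X)
    {f g : StrongDual 𝕜 X} (h : ∀ j, f (e j) = g (e j)) : f = g := by
  ext x
  have hx : Tendsto (fun A => e.proj A x) (SummationFilter.unconditional ℕ).filter (𝓝 x) :=
    e.tendsto_proj x
  refine tendsto_nhds_unique ((f.continuous.tendsto x).comp hx)
    (((g.continuous.tendsto x).comp hx).congr fun A => ?_)
  simp [h]

theorem UniformlyComplexConvex.norm_le_of_forall_norm_add_le {E : Type*} [NormedAddCommGroup E]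
    [NormedSpace ℂ E] (hE : UniformlyComplexConvex E) {ε : ℝ} (hε : 0 < ε) :
    ∃ δ : ℝ, 0 < δ ∧ ∀ u v : E, (∀ θ : ℝ, ‖u + Complex.exp (θ * Complex.I) • v‖ ≤ 1) →
      1 - δ ≤ ‖u‖ → ‖v‖ ≤ ε := by
  obtain ⟨d, hd, H⟩ := hE ε hε
  -- After normalizing `u`, a large `v` would force `(1 + d) * ‖u‖ ≤ 1`; this constant is half of `1
  -- - 1 / (1 + d)`.
  refine ⟨d / (2 * (1 + d)), by positivity, fun u v huv hu => ?_⟩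
  have hprod : d / (2 * (1 + d)) * (1 + d) = d / 2 := by field_simp
  have hupos : 0 < ‖u‖ := by
    have : d / (2 * (1 + d)) < 1 := by rw [div_lt_one (by positivity)]; linarith
    linarith
  have hu1 : ‖u‖ ≤ 1 := by
    have h0 := huv 0
    have h1 := huv Real.pi
    simp only [Complex.ofReal_zero, zero_mul, Complex.exp_zero, one_smul, Complex.exp_pi_mul_I,
      neg_smul] at h0 h1
    have h2 : ‖(2 : ℂ) • u‖ ≤ 1 + 1 := by
      have : (2 : ℂ) • u = (u + v) + (u + -v) := by rw [two_smul]; abel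
      rw [this]
      exact norm_add_le_of_le h0 h1
    rw [norm_smul] at h2
    norm_num at h2
    linarith
  by_contra! hv
  have hn : ‖((‖u‖⁻¹ : ℝ) : ℂ)‖ = ‖u‖⁻¹ := by
    rw [Complex.norm_real, Real.norm_of_nonneg (by positivity)]
  obtain ⟨θ, hθ⟩ := H (((‖u‖⁻¹ : ℝ) : ℂ) • u) (((‖u‖⁻¹ : ℝ) : ℂ) • v)
    (by rw [norm_smul, hn, inv_mul_cancel₀ hupos.ne'])
    (by
      rw [norm_smul, hn]
      have := one_le_inv_iff₀.2 ⟨hupos, hu1⟩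
      nlinarith [norm_nonneg v])
  rw [smul_comm, ← smul_add, norm_smul, hn] at hθ
  have h3 : ‖u‖⁻¹ * ‖u + Complex.exp (θ * Complex.I) • v‖ ≤ ‖u‖⁻¹ * 1 := by
    gcongr
    exact huv θ
  have h4 : (1 + d) * ‖u‖ ≤ 1 := by
    have := mul_le_mul_of_nonneg_right (hθ.trans h3) hupos.le
    rwa [mul_one, inv_mul_cancel₀ hupos.ne'] at this
  nlinarith

/-! ### Initial segments and truncation to the ball -/

/-- The sequence of weights that is `1` on the first `⌊s⌋` indices, the fractional part of `s` at
the next one, and `0` afterwards. -/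
noncomputable def cutoff (s : ℝ) (j : ℕ) : ℝ := max 0 (min 1 (s - j))

theorem cutoff_nonneg (s : ℝ) (j : ℕ) : 0 ≤ cutoff s j := le_max_left _ _

theorem cutoff_le_one (s : ℝ) (j : ℕ) : cutoff s j ≤ 1 :=
  max_le zero_le_one (min_le_left _ _)

theorem cutoff_mono {s t : ℝ} (h : s ≤ t) (j : ℕ) : cutoff s j ≤ cutoff t j := by
  unfold cutoff
  gcongr

theorem cutoff_eq_zero {s : ℝ} {j : ℕ} (h : s ≤ j) : cutoff s j = 0 :=
  max_eq_left ((min_le_right _ _).trans (by linarith))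

theorem cutoff_eq_one {s : ℝ} {j n : ℕ} (hj : j < n) (h : (n : ℝ) ≤ s) : cutoff s j = 1 := by
  have : (j : ℝ) + 1 ≤ n := by exact_mod_cast hj
  unfold cutoff
  rw [min_eq_left (by linarith), max_eq_right zero_le_one]

theorem continuous_cutoff (j : ℕ) : Continuous fun s => cutoff s j := by
  unfold cutoff
  fun_prop

section Truncation

variable {X : Type*} [NormedAddCommGroup X] [NormedSpace ℂ X]

/-- The functional whose first `N` coordinates are those of `f`, multiplied by the weights `w`, and
whose other coordinates vanish. -/
noncomputable def weightedSection (e : UnconditionalSchauderBasis ℕ ℂ X) (N : ℕ) (w : ℕ → ℝ)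
    (f : StrongDual ℂ X) : StrongDual ℂ X :=
  ∑ j ∈ Finset.range N, ((w j : ℂ) * f (e j)) • e.coord j

theorem weightedSection_apply_basis (e : UnconditionalSchauderBasis ℕ ℂ X) (N : ℕ) (w : ℕ → ℝ)
    (f : StrongDual ℂ X) (j : ℕ) :
    weightedSection e N w f (e j) = if j < N then (w j : ℂ) * f (e j) else 0 := by
  simp [weightedSection, e.ortho, Pi.single_apply]

theorem weightedSection_cutoff_apply_basis (e : UnconditionalSchauderBasis ℕ ℂ X) {N : ℕ} {s : ℝ}
    (hs : s ≤ N) (f : StrongDual ℂ X) (j : ℕ) :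
    weightedSection e N (cutoff s) f (e j) = (cutoff s j : ℂ) * f (e j) := by
  rw [weightedSection_apply_basis]
  split_ifs with hj
  · rfl
  · rw [cutoff_eq_zero (hs.trans (by exact_mod_cast not_lt.1 hj))]
    simp

/-- `g` is a truncation of `f` to the unit ball along the basis `e`: either `f` lies in the ball
and `g = f`, or `g` is an initial segment of `f` that has norm one. -/
def IsBallTruncation (e : UnconditionalSchauderBasis ℕ ℂ X) (f g : StrongDual ℂ X) : Prop :=
  (‖f‖ ≤ 1 ∧ g = f) ∨ (‖g‖ = 1 ∧ ∃ s : ℝ, ∀ j, g (e j) = (cutoff s j : ℂ) * f (e j))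

theorem IsBallTruncation.norm_le_one {e : UnconditionalSchauderBasis ℕ ℂ X} {f g : StrongDual ℂ X}
    (h : IsBallTruncation e f g) : ‖g‖ ≤ 1 := by
  rcases h with ⟨h, rfl⟩ | ⟨h, -⟩
  exacts [h, h.le]

/-- The sections need not converge to `f` in norm; it is enough that they agree with `f` on finite
combinations of the basis. -/
theorem exists_one_lt_norm_weightedSection {e : UnconditionalSchauderBasis ℕ ℂ X}
    {f : StrongDual ℂ X} (hf : 1 < ‖f‖) :
    ∃ N : ℕ, 1 < ‖weightedSection e N (fun _ => 1) f‖ := by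
  by_contra! H
  refine hf.not_ge (f.opNorm_le_bound zero_le_one fun x => ?_)
  have hx : Tendsto (fun A => e.proj A x) (SummationFilter.unconditional ℕ).filter (𝓝 x) :=
    e.tendsto_proj x
  refine le_of_tendsto_of_tendsto ((f.continuous.tendsto x).comp hx).norm
    (hx.norm.const_mul 1) (Eventually.of_forall fun A => ?_)
  obtain ⟨N, hN⟩ : ∃ N, ∀ j ∈ A, j < N := ⟨A.sup id + 1, fun j hj =>
    Nat.lt_succ_of_le (Finset.le_sup (f := id) hj)⟩
  have : f (e.proj A x) = weightedSection e N (fun _ => 1) f (e.proj A x) := by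
    simp only [GeneralSchauderBasis.proj_apply, map_sum, map_smul]
    refine Finset.sum_congr rfl fun j hj => ?_
    rw [weightedSection_apply_basis, if_pos (hN j hj)]
    simp
  simp only [Function.comp_apply]
  rw [this]
  exact (weightedSection e N (fun _ => 1) f).le_of_opNorm_le (H N) _

/-- The fractional weight makes the norm of the segment continuous in `s`, so the intermediate value
theorem gives a stopping point. -/
theorem exists_isBallTruncation (e : UnconditionalSchauderBasis ℕ ℂ X) (f : StrongDual ℂ X) :
    ∃ g, IsBallTruncation e f g := by
  by_cases hf : ‖f‖ ≤ 1
  · exact ⟨f, Or.inl ⟨hf, rfl⟩⟩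
  obtain ⟨N, hN⟩ := exists_one_lt_norm_weightedSection (e := e) (not_le.1 hf)
  have hcont : Continuous fun s => ‖weightedSection e N (cutoff s) f‖ := by
    refine continuous_norm.comp (continuous_finsetSum _ fun j _ => ?_)
    exact ((Complex.continuous_ofReal.comp (continuous_cutoff j)).mul continuous_const).smul
      continuous_const
  have h0 : ‖weightedSection e N (cutoff 0) f‖ ≤ 1 := by
    have : weightedSection e N (cutoff 0) f = 0 := Finset.sum_eq_zero fun j _ => by
      rw [cutoff_eq_zero (Nat.cast_nonneg j), Complex.ofReal_zero, zero_mul]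
      exact zero_smul ℂ (e.coord j)
    simp [this]
  have h1 : 1 ≤ ‖weightedSection e N (cutoff N) f‖ := by
    have : weightedSection e N (cutoff N) f = weightedSection e N (fun _ => 1) f :=
      Finset.sum_congr rfl fun j hj => by
        rw [cutoff_eq_one (Finset.mem_range.1 hj) le_rfl]
    rw [this]
    exact hN.le
  obtain ⟨s, hs, hs1⟩ := intermediate_value_Icc (Nat.cast_nonneg N) hcont.continuousOn ⟨h0, h1⟩
  exact ⟨_, Or.inr ⟨hs1, s, weightedSection_cutoff_apply_basis e hs.2 f⟩⟩

theorem norm_sub_le_of_initial_segments {e : UnconditionalSchauderBasis ℕ ℂ X}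
    (hunc : unconditionalBasisConstant e ≤ 1) {ε δ : ℝ}
    (hδ : ∀ u v : StrongDual ℂ X, (∀ θ : ℝ, ‖u + Complex.exp (θ * Complex.I) • v‖ ≤ 1) →
      1 - δ ≤ ‖u‖ → ‖v‖ ≤ ε)
    {f f' g g' : StrongDual ℂ X} {s : ℝ} {w : ℕ → ℝ} (hw : ∀ j, cutoff s j ≤ w j)
    (hg : ∀ j, g (e j) = (cutoff s j : ℂ) * f (e j)) (hg1 : ‖g‖ = 1)
    (hg' : ∀ j, g' (e j) = (w j : ℂ) * f' (e j)) (hg'1 : ‖g'‖ ≤ 1) (hff' : ‖f - f'‖ ≤ δ) :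
    ‖g - g'‖ ≤ ‖f - f'‖ + ε := by
  obtain ⟨N, hN⟩ := exists_nat_ge s
  set u := weightedSection e N (cutoff s) f'
  have hu : ∀ j, u (e j) = (cutoff s j : ℂ) * f' (e j) :=
    weightedSection_cutoff_apply_basis e hN f'
  have hgu : ‖g - u‖ ≤ ‖f - f'‖ := by
    refine norm_le_norm_of_norm_apply_basis_le hunc fun j => ?_
    rw [sub_apply, sub_apply, hg, hu, ← mul_sub, norm_mul,
      Complex.norm_of_nonneg (cutoff_nonneg s j)]
    exact mul_le_of_le_one_left (norm_nonneg _) (cutoff_le_one s j)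
  have hv : ‖g' - u‖ ≤ ε := by
    refine hδ u (g' - u) (fun θ => le_trans ?_ hg'1) ?_
    · refine norm_le_norm_of_norm_apply_basis_le hunc fun j => ?_
      rw [add_apply, smul_apply, sub_apply, hu, hg', ← sub_mul, smul_eq_mul, ← mul_assoc,
        ← add_mul, norm_mul, norm_mul, ← Complex.ofReal_sub]
      gcongr
      refine (norm_add_le _ _).trans (le_of_eq ?_)
      rw [norm_mul, Complex.norm_exp_ofReal_mul_I, Complex.norm_of_nonneg (cutoff_nonneg s j),
        Complex.norm_of_nonneg (sub_nonneg.2 (hw j)),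
        Complex.norm_of_nonneg ((cutoff_nonneg s j).trans (hw j))]
      ring
    · have := norm_le_norm_add_norm_sub' g u
      linarith
  calc ‖g - g'‖ = ‖(g - u) - (g' - u)‖ := by congr 1; abel
    _ ≤ ‖f - f'‖ + ε := norm_sub_le_of_le hgu hv

theorem IsBallTruncation.norm_sub_le {e : UnconditionalSchauderBasis ℕ ℂ X}
    (hunc : unconditionalBasisConstant e ≤ 1) {ε δ : ℝ} (hε : 0 ≤ ε)
    (hδ : ∀ u v : StrongDual ℂ X, (∀ θ : ℝ, ‖u + Complex.exp (θ * Complex.I) • v‖ ≤ 1) →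
      1 - δ ≤ ‖u‖ → ‖v‖ ≤ ε)
    {f f' g g' : StrongDual ℂ X} (h : IsBallTruncation e f g) (h' : IsBallTruncation e f' g')
    (hff' : ‖f - f'‖ ≤ δ) : ‖g - g'‖ ≤ ‖f - f'‖ + ε := by
  rcases h with ⟨hf, rfl⟩ | ⟨hg1, s, hg⟩ <;> rcases h' with ⟨hf', rfl⟩ | ⟨hg'1, s', hg'⟩
  · linarith
  · rw [norm_sub_rev, norm_sub_rev g f'] at *
    -- A functional in the ball is never cut: its weights are all `1`.
    exact norm_sub_le_of_initial_segments hunc hδ (w := fun _ => 1) (cutoff_le_one s') hg' hg'1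
      (by simp) hf hff'
  · exact norm_sub_le_of_initial_segments hunc hδ (w := fun _ => 1) (cutoff_le_one s) hg hg1
      (by simp) hf' hff'
  · rcases le_total s s' with hs | hs
    · exact norm_sub_le_of_initial_segments hunc hδ (cutoff_mono hs) hg hg1 hg' hg'1.le hff'
    · rw [norm_sub_rev, norm_sub_rev f f'] at *
      exact norm_sub_le_of_initial_segments hunc hδ (cutoff_mono hs) hg' hg'1 hg hg1.le hff'

/-- The stopping point may not be unique, but the stability estimate with `f = f'` bounds the
distance by every `ε > 0`. -/
theorem IsBallTruncation.unique {e : UnconditionalSchauderBasis ℕ ℂ X}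
    (hunc : unconditionalBasisConstant e ≤ 1) (hconv : UniformlyComplexConvex (StrongDual ℂ X))
    {f g g' : StrongDual ℂ X} (h : IsBallTruncation e f g) (h' : IsBallTruncation e f g') :
    g = g' := by
  rw [← sub_eq_zero, ← norm_le_zero_iff]
  refine le_of_forall_pos_le_add fun ε hε => ?_
  obtain ⟨δ, hδ0, hδ⟩ := hconv.norm_le_of_forall_norm_add_le hε
  simpa using h.norm_sub_le hunc hε.le hδ h' (by simpa using hδ0.le)

/-! ### Weak-* continuity -/

/-- The first `n` coordinates of a truncation of `f` only depend on the first `n` coordinates of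
`f`. -/
theorem IsBallTruncation.exists_section {e : UnconditionalSchauderBasis ℕ ℂ X}
    (hunc : unconditionalBasisConstant e ≤ 1) {f g : StrongDual ℂ X}
    (h : IsBallTruncation e f g) (n : ℕ) :
    ∃ g', IsBallTruncation e (weightedSection e n (fun _ => 1) f) g' ∧
      ∀ j < n, g' (e j) = g (e j) := by
  have hagree : (∀ j < n, g (e j) = f (e j)) →
      ∃ g', IsBallTruncation e (weightedSection e n (fun _ => 1) f) g' ∧
        ∀ j < n, g' (e j) = g (e j) := fun hj => by
    refine ⟨_, Or.inl ⟨le_trans ?_ h.norm_le_one, rfl⟩, fun j hjn => ?_⟩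
    · refine norm_le_norm_of_norm_apply_basis_le hunc fun j => ?_
      rw [weightedSection_apply_basis]
      split_ifs with hjn
      · simp [hj j hjn]
      · simp
    · simp [weightedSection_apply_basis, hjn, hj j hjn]
  rcases h with ⟨-, rfl⟩ | ⟨hg1, s, hg⟩
  · exact hagree fun _ _ => rfl
  -- If the cut falls within the first `n` coordinates, `g` also truncates the section; otherwise
  -- these coordinates are uncut and the section is already in the ball.
  rcases le_total s n with hs | hs
  · refine ⟨g, Or.inr ⟨hg1, s, fun j => ?_⟩, fun _ _ => rfl⟩
    rw [hg, weightedSection_apply_basis]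
    split_ifs with hj
    · simp
    · simp [cutoff_eq_zero (hs.trans (by exact_mod_cast not_lt.1 hj : (n : ℝ) ≤ j))]
  · exact hagree fun j hj => by simp [hg, cutoff_eq_one hj hs]

/-- A map into the unit ball of the dual is weak-* continuous as soon as its coordinates are. -/
theorem continuous_toWeakDual_of_apply_basis {α : Type*} [TopologicalSpace α]
    (e : UnconditionalSchauderBasis ℕ ℂ X) {F : α → StrongDual ℂ X} (hF : ∀ a, ‖F a‖ ≤ 1)
    (h : ∀ j, Continuous fun a => F a (e j)) :
    Continuous fun a => StrongDual.toWeakDual (F a) := by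
  refine WeakDual.continuous_of_continuous_eval fun x => ?_
  refine continuous_of_uniform_approx_of_continuous fun U hU => ?_
  obtain ⟨ε, hε, hεU⟩ := Metric.mem_uniformity_dist.1 hU
  have hx : Tendsto (fun A => e.proj A x) (SummationFilter.unconditional ℕ).filter (𝓝 x) :=
    e.tendsto_proj x
  obtain ⟨A, hA⟩ := (hx.eventually (Metric.ball_mem_nhds x hε)).exists
  refine ⟨fun a => F a (e.proj A x), ?_, fun a => hεU ?_⟩
  · simp only [GeneralSchauderBasis.proj_apply, map_sum, map_smul]
    exact continuous_finsetSum _ fun j _ => continuous_const.mul (h j)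
  · change dist (F a x) (F a (e.proj A x)) < ε
    rw [dist_eq_norm, ← map_sub]
    refine ((F a).le_of_opNorm_le (hF a) _).trans_lt ?_
    rw [one_mul, ← dist_eq_norm, dist_comm]
    exact hA

end Truncation

theorem mainTheorem6 {X : Type*} [NormedAddCommGroup X] [NormedSpace ℂ X] [CompleteSpace X]
    (e : UnconditionalSchauderBasis ℕ ℂ X) (he : ∀ j, ‖e j‖ = 1)
    (hunc : unconditionalBasisConstant e = 1)
    (hconv : UniformlyComplexConvex (StrongDual ℂ X)) :
    AdmitsUniformlySimultaneouslyContinuousRetraction ℂ X := by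
  choose r hr using exists_isBallTruncation e
  have huc : UniformContinuous r := by
    refine Metric.uniformContinuous_iff.2 fun ε hε => ?_
    obtain ⟨δ, hδ0, hδ⟩ := hconv.norm_le_of_forall_norm_add_le (half_pos hε)
    refine ⟨min δ (ε / 2), by positivity, fun f f' hff' => ?_⟩
    rw [dist_eq_norm] at hff' ⊢
    have h1 := hff'.trans_le (min_le_left _ _)
    have h2 := hff'.trans_le (min_le_right _ _)
    have h3 := (hr f).norm_sub_le hunc.le (half_pos hε).le hδ (hr f') h1.le
    linarith
  refine ⟨r, fun f => (hr f).norm_le_one,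
    fun f hf => (hr f).unique hunc.le hconv (Or.inl ⟨hf, rfl⟩), huc,
    continuous_toWeakDual_of_apply_basis e (fun f => (hr _).norm_le_one) fun j => ?_⟩
  -- Sections have finite rank, so they are continuous from the weak-* topology to the norm.
  have hsec : Continuous fun f : WeakDual ℂ X =>
      weightedSection e (j + 1) (fun _ => 1) (WeakDual.toStrongDual f) :=
    continuous_finsetSum _ fun i _ =>
      (continuous_const.mul (WeakDual.eval_continuous (e i))).smul continuous_const
  have heval : Continuous fun f : WeakDual ℂ X =>
      r (weightedSection e (j + 1) (fun _ => 1) (WeakDual.toStrongDual f)) (e j) :=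
    (ContinuousLinearMap.apply ℂ ℂ (e j)).continuous.comp (huc.continuous.comp hsec)
  refine heval.congr fun f => ?_
  obtain ⟨g', hg', hg'j⟩ := (hr (WeakDual.toStrongDual f)).exists_section hunc.le (j + 1)
  rw [(hr _).unique hunc.le hconv hg', hg'j j (Nat.lt_succ_self j)]
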